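/- Let $\mathbb K\in\{\mathbb R,\mathbb C\}$, let $(X,\|\cdot\|)$ be a normed space over $\mathbb K$ (not assumed complete), with dual $X^*$ carrying the dual norm $\|\cdot\|_{X^*}$, and let $\tau$ be a Hausdorff locally convex topology on $X$ that is coarser than the norm topology $\tau_{\|\cdot\|}$. Assume that $(X,\|\cdot\|,\tau)$ is a Saks space, i.e. there is a directed system $\Gamma_\tau$ of continuous seminorms generating $\tau$ such that $\|x\|=\sup_{q\in\Gamma_\tau}q(x)$ for all $x\in X$. Let $\gamma$ be the mixed topology, i.e. the finest linear topology on $X$ that coincides with $\tau$ on $\|\cdot\|$-bounded sets and satisfies $\tau\le\gamma\le\tau_{\|\cdot\|}$. Let $X_\gamma'$ be the topological dual of $(X,\gamma)$, $\|\cdot\|_{X_\gamma'}$ the restriction of $\|\cdot\|_{X^*}$ to $X_\gamma'$, and let $(X,\gamma)_b'$ be $X_\gamma'$ with the topology of uniform convergence on $\gamma$-bounded sets. (a) $X_\gamma'$ is a $\|\cdot\|_{X^*}$-closed subspace of $X^*$, and $(X,\gamma)_b'$ is completely normable by $\|\cdot\|_{X_\gamma'}$, i.e. $(X_\gamma',\|\cdot\|_{X_\gamma'})$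 is a Banach space and the identity $(X,\gamma)_b'\to(X_\gamma',\|\cdot\|_{X_\gamma'})$ is a topological isomorphism. (b) If $(X,\gamma)$ is semi-reflexive, i.e. the canonical map from $X$ into the dual of $(X,\gamma)_b'$ is surjective, then the evaluation map $\mathcal I\colon (X,\|\cdot\|)\to(X_\gamma',\|\cdot\|_{X_\gamma'})^*$, $x\mapsto[x'\mapsto x'(x)]$, is an isometric isomorphism. In particular, $(X,\|\cdot\|)$ is an isometric bidual Banach space with isometric prebidual $((X,\gamma),\mathcal I)$ and isometric Banach predual $((X_\gamma',\|\cdot\|_{X_\gamma'}),\mathcal I)$. Here an isometric Banach predual of $X$ is a pair $(Z,\varphi)$ of a Banach space $Z$ and an isometric isomorphism $\varphi\colon X\to Z^*$. An isometric prebidual of $X$ is a pair $(Y,\varphi)$ of a locally convex Hausdorff space $Y$, whose strong dual $Y_b'$ is completely normable by some norm $|||\cdot|||$ on $Y'$, and an isometric isomorphism $\varphi\colon X\to(Y',|||\cdot|||)^*$; $X$ is an isometric bidual Banach space if it has an isometric prebidual. -/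

import Mathlib

open Topology

noncomputable section

/-! Norms on a vector space (as data) and complete normability. -/

/-- A norm on the `𝕜`-vector space `Z`: a seminorm vanishing only at `0`. -/
structure LinearNorm (𝕜 : Type*) (Z : Type*) [RCLike 𝕜] [AddCommGroup Z] [Module 𝕜 Z]
    extends Seminorm 𝕜 Z where
  eq_zero_of_map_eq_zero' : ∀ z : Z, toFun z = 0 → z = 0

section NormedBy

variable {𝕜 : Type*} {Z : Type*} [RCLike 𝕜] [AddCommGroup Z] [Module 𝕜 Z]

/-- The normed space `(Z, N)`: a copy of `Z` whose norm is `N`, disregarding any topology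
that `Z` may already carry. -/
def NormedBy (_ : LinearNorm 𝕜 Z) : Type _ := Z

/-- The identity map `Z → (Z, N)`. -/
def toNormedBy (N : LinearNorm 𝕜 Z) : Z → NormedBy N := fun z => z

instance (N : LinearNorm 𝕜 Z) : AddCommGroup (NormedBy N) := inferInstanceAs (AddCommGroup Z)

instance (N : LinearNorm 𝕜 Z) : Module 𝕜 (NormedBy N) := inferInstanceAs (Module 𝕜 Z)

theorem LinearNorm.core (N : LinearNorm 𝕜 Z) :
    @NormedSpace.Core 𝕜 (NormedBy N) _ _ _ ⟨fun z => N.toSeminorm z⟩ :=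
  letI : Norm (NormedBy N) := ⟨fun z => N.toSeminorm z⟩
  { norm_nonneg := fun z => apply_nonneg N.toSeminorm z
    norm_smul := fun c z => map_smul_eq_mul N.toSeminorm c z
    norm_triangle := fun x y => map_add_le_add N.toSeminorm x y
    norm_eq_zero_iff := fun z =>
      ⟨fun h => N.eq_zero_of_map_eq_zero' z h, fun h => by
        subst h; exact map_zero N.toSeminorm⟩ }

instance (N : LinearNorm 𝕜 Z) : NormedAddCommGroup (NormedBy N) :=
  letI : Norm (NormedBy N) := ⟨fun z => N.toSeminorm z⟩
  NormedAddCommGroup.ofCore N.core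

instance (N : LinearNorm 𝕜 Z) : NormedSpace 𝕜 (NormedBy N) :=
  letI : Norm (NormedBy N) := ⟨fun z => N.toSeminorm z⟩
  NormedSpace.ofCore N.core

theorem norm_toNormedBy (N : LinearNorm 𝕜 Z) (z : Z) : ‖toNormedBy N z‖ = N.toSeminorm z := rfl

/-- The topological vector space `Z` is completely normable by the norm `N`: `(Z, N)` is a Banach
space and the identity `Z → (Z, N)` is a topological isomorphism. -/
def IsCompletelyNormableBy [TopologicalSpace Z] (N : LinearNorm 𝕜 Z) : Prop :=
  CompleteSpace (NormedBy N) ∧ IsHomeomorph (toNormedBy N)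

end NormedBy

/-! Isometric isomorphisms, Banach preduals, prebiduals, semi-reflexivity.
For a topological vector space `Y`, Mathlib's `StrongDual 𝕜 Y` is the topological dual with the
topology of uniform convergence on (von Neumann) bounded sets; for a normed space it carries the
dual norm. -/

/-- The linear map `φ` is an isometric isomorphism of normed spaces. -/
def IsIsometricIso {𝕜 : Type*} [RCLike 𝕜] {E F : Type*} [NormedAddCommGroup E] [NormedSpace 𝕜 E]
    [NormedAddCommGroup F] [NormedSpace 𝕜 F] (φ : E →ₗ[𝕜] F) : Prop :=
  Function.Bijective φ ∧ ∀ x, ‖φ x‖ = ‖x‖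

/-- `(Z, φ)` is an isometric Banach predual of the normed space `X`. -/
def IsIsometricBanachPredual {𝕜 : Type*} [RCLike 𝕜] {X : Type*} [NormedAddCommGroup X]
    [NormedSpace 𝕜 X] (Z : Type*) [NormedAddCommGroup Z] [NormedSpace 𝕜 Z]
    (φ : X →ₗ[𝕜] StrongDual 𝕜 Z) : Prop :=
  CompleteSpace Z ∧ IsIsometricIso φ

/-- `(Y, φ)` is an isometric prebidual of the normed space `X`, with respect to the norm `N` on the
dual of `Y`: `Y` is a locally convex Hausdorff space, the strong dual of `Y` is completely normable
by `N`, and `φ` is an isometric isomorphism of `X` onto the normed dual of `(Y', N)`. -/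
def IsIsometricPrebidual {𝕜 : Type*} [RCLike 𝕜] {X : Type*} [NormedAddCommGroup X]
    [NormedSpace 𝕜 X] (Y : Type*) [AddCommGroup Y] [Module 𝕜 Y] [TopologicalSpace Y]
    [IsTopologicalAddGroup Y] [ContinuousSMul 𝕜 Y] (N : LinearNorm 𝕜 (StrongDual 𝕜 Y))
    (φ : X →ₗ[𝕜] StrongDual 𝕜 (NormedBy N)) : Prop :=
  PolynormableSpace 𝕜 Y ∧ T2Space Y ∧ IsCompletelyNormableBy N ∧ IsIsometricIso φ

/-- `X` is an isometric bidual Banach space, i.e. it has an isometric prebidual. -/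
def IsIsometricBidualBanachSpace.{u, v} (𝕜 : Type u) [RCLike 𝕜] (X : Type v) [NormedAddCommGroup X]
    [NormedSpace 𝕜 X] : Prop :=
  ∃ (Y : Type v) (_ : AddCommGroup Y) (_ : Module 𝕜 Y) (_ : TopologicalSpace Y)
    (_ : IsTopologicalAddGroup Y) (_ : ContinuousSMul 𝕜 Y) (N : LinearNorm 𝕜 (StrongDual 𝕜 Y))
    (φ : X →ₗ[𝕜] StrongDual 𝕜 (NormedBy N)), IsIsometricPrebidual Y N φ

/-- A topological vector space `E` is semi-reflexive if the canonical map from `E` into the dual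
of its strong dual is surjective. -/
def IsSemiReflexive (𝕜 : Type*) [RCLike 𝕜] (E : Type*) [AddCommGroup E] [Module 𝕜 E]
    [TopologicalSpace E] [IsTopologicalAddGroup E] [ContinuousSMul 𝕜 E] : Prop :=
  ∀ Φ : StrongDual 𝕜 (StrongDual 𝕜 E), ∃ x : E, ∀ f : StrongDual 𝕜 E, Φ f = f x

/-! Saks spaces and the mixed topology. Mathlib orders topologies so that `s ≤ t` means that `s` is
finer than `t`. -/

/-- The topology induced by the norm. -/
abbrev normTopology (X : Type*) [NormedAddCommGroup X] : TopologicalSpace X := inferInstance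

/-- `σ` is a linear topology on `X`. -/
def IsVectorTopology (𝕜 : Type*) [RCLike 𝕜] {X : Type*} [AddCommGroup X] [Module 𝕜 X]
    (σ : TopologicalSpace X) : Prop :=
  @IsTopologicalAddGroup X σ _ ∧ @ContinuousSMul 𝕜 X _ _ σ

/-- A pre-Saks space `(X, ‖·‖, τ)` over the normed space `X`: a locally convex Hausdorff topology
`τ` on `X` (i.e. a linear Hausdorff topology generated by seminorms) which is coarser than the norm
topology. -/
structure PreSaksSpace (𝕜 : Type*) [RCLike 𝕜] (X : Type*) [NormedAddCommGroup X]
    [NormedSpace 𝕜 X] where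
  tau : TopologicalSpace X
  isLinearTopology : IsVectorTopology 𝕜 tau
  polynormable : @PolynormableSpace 𝕜 X _ _ _ tau
  t2 : @T2Space X tau
  normTopology_le : normTopology X ≤ tau

/-- A Saks space: a pre-Saks space with a directed system `Γ` of continuous seminorms generating `τ`
such that `‖x‖ = sup_{q ∈ Γ} q x` for all `x`. -/
structure SaksSpace (𝕜 : Type*) [RCLike 𝕜] (X : Type*) [NormedAddCommGroup X]
    [NormedSpace 𝕜 X] extends PreSaksSpace 𝕜 X where
  exists_seminorms : ∃ Γ : Set (Seminorm 𝕜 X), DirectedOn (· ≤ ·) Γ ∧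
    @WithSeminorms 𝕜 X Γ _ _ _ (fun q => (q : Seminorm 𝕜 X)) tau ∧
    ∀ x : X, IsLUB {r : ℝ | ∃ q ∈ Γ, r = q x} ‖x‖

namespace PreSaksSpace

variable {𝕜 : Type*} [RCLike 𝕜] {X : Type*} [NormedAddCommGroup X] [NormedSpace 𝕜 X]

/-- The linear topologies between `τ` and the norm topology that coincide with `τ` on
norm-bounded sets. -/
def admissible (S : PreSaksSpace 𝕜 X) : Set (TopologicalSpace X) :=
  {σ | IsVectorTopology 𝕜 σ ∧
    (∀ B : Set X, Bornology.IsBounded B →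
      TopologicalSpace.induced ((↑) : B → X) σ = TopologicalSpace.induced ((↑) : B → X) S.tau) ∧
    σ ≤ S.tau ∧ normTopology X ≤ σ}

/-- The mixed topology `γ(‖·‖, τ)`, the finest of the admissible topologies
(see `isLeast_mixedTopology`). -/
@[reducible] def mixedTopology (S : PreSaksSpace 𝕜 X) : TopologicalSpace X := sInf S.admissible

theorem normTopology_le_mixedTopology (S : PreSaksSpace 𝕜 X) :
    normTopology X ≤ S.mixedTopology :=
  le_sInf fun _ h => h.2.2.2

theorem isLinearTopology_mixedTopology (S : PreSaksSpace 𝕜 X) :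
    IsVectorTopology 𝕜 S.mixedTopology :=
  ⟨topologicalAddGroup_sInf fun _ h => h.1.1, continuousSMul_sInf fun _ h => h.1.2⟩

theorem tau_mem_admissible (S : PreSaksSpace 𝕜 X) : S.tau ∈ S.admissible :=
  ⟨S.isLinearTopology, fun _ _ => rfl, le_rfl, S.normTopology_le⟩

/-- The mixed topology is the finest admissible topology. -/
theorem isLeast_mixedTopology (S : PreSaksSpace 𝕜 X) :
    IsLeast S.admissible S.mixedTopology := by
  refine ⟨⟨S.isLinearTopology_mixedTopology, fun B hB => ?_, sInf_le S.tau_mem_admissible,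
    S.normTopology_le_mixedTopology⟩, fun σ hσ => sInf_le hσ⟩
  rw [mixedTopology, induced_sInf]
  refine le_antisymm (sInf_le ⟨_, S.tau_mem_admissible, rfl⟩) (le_sInf ?_)
  rintro _ ⟨σ, hσ, rfl⟩
  exact (hσ.2.1 B hB).ge

end PreSaksSpace

section Mixed

variable {𝕜 : Type*} [RCLike 𝕜] {X : Type*} [NormedAddCommGroup X] [NormedSpace 𝕜 X]

/-- The space `(X, γ)`: a copy of the vector space `X` with the mixed topology. -/
def MixedSpace (_ : PreSaksSpace 𝕜 X) : Type _ := X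

variable (S : PreSaksSpace 𝕜 X)

instance : AddCommGroup (MixedSpace S) := inferInstanceAs (AddCommGroup X)

instance : Module 𝕜 (MixedSpace S) := inferInstanceAs (Module 𝕜 X)

instance : TopologicalSpace (MixedSpace S) := S.mixedTopology

instance : IsTopologicalAddGroup (MixedSpace S) := S.isLinearTopology_mixedTopology.1

instance : ContinuousSMul 𝕜 (MixedSpace S) := S.isLinearTopology_mixedTopology.2

/-- The identity map `X → (X, γ)`. -/
def toMixed : X →L[𝕜] MixedSpace S where
  toFun x := x
  map_add' _ _ := rfl
  map_smul' _ _ := rfl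
  cont := continuous_id_iff_le.2 S.normTopology_le_mixedTopology

/-- The inclusion of the dual of `(X, γ)` into the normed dual of `X`. -/
def mixedDualIncl : StrongDual 𝕜 (MixedSpace S) →ₗ[𝕜] StrongDual 𝕜 X where
  toFun f := f.comp (toMixed S)
  map_add' _ _ := rfl
  map_smul' _ _ := rfl

theorem mixedDualIncl_injective : Function.Injective (mixedDualIncl S) := by
  intro f g h
  ext x
  exact DFunLike.congr_fun h (x : X)

/-- The dual of `(X, γ)`, as a linear subspace of the normed dual of `X`. -/
def mixedDual : Submodule 𝕜 (StrongDual 𝕜 X) := LinearMap.range (mixedDualIncl S)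

/-- The restriction of the dual norm to the dual of `(X, γ)`. -/
def mixedDualNorm : LinearNorm 𝕜 (StrongDual 𝕜 (MixedSpace S)) where
  toSeminorm := (normSeminorm 𝕜 (StrongDual 𝕜 X)).comp (mixedDualIncl S)
  eq_zero_of_map_eq_zero' f hf := by
    have h : ‖mixedDualIncl S f‖ = 0 := hf
    exact mixedDualIncl_injective S (by rw [norm_eq_zero.1 h, map_zero])

/-- The evaluation map `x ↦ (f ↦ f x)` from `X` into the normed dual of the dual of `(X, γ)`,
the latter being equipped with the restriction of the dual norm. -/
def mixedEval : X →ₗ[𝕜] StrongDual 𝕜 (NormedBy (mixedDualNorm S)) where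
  toFun x := LinearMap.mkContinuous
    (show StrongDual 𝕜 (MixedSpace S) →ₗ[𝕜] 𝕜 from
      { toFun := fun f => f (toMixed S x)
        map_add' := fun _ _ => rfl
        map_smul' := fun _ _ => rfl }) ‖x‖
    (fun f => by
      rw [mul_comm]
      exact (mixedDualIncl S f).le_opNorm x)
  map_add' x y := by
    ext f
    exact map_add (show StrongDual 𝕜 (MixedSpace S) from f) (toMixed S x) (toMixed S y)
  map_smul' c x := by
    ext f
    exact map_smul (show StrongDual 𝕜 (MixedSpace S) from f) c (toMixed S x)

theorem mixedEval_apply (x : X) (f : StrongDual 𝕜 (MixedSpace S)) :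
    mixedEval S x (toNormedBy (mixedDualNorm S) f) = f (toMixed S x) := rfl

end Mixed

end

/-! A seminorm is `γ`-continuous iff it is `τ`-continuous at `0` on every norm-bounded set
(`IsContinuousOnBounded`): otherwise it could be adjoined to `τ` to give an admissible topology not
coarser than `γ`. Hence `X_γ'` consists of the functionals that are `τ`-continuous on balls, a
condition stable under uniform limits on balls; so `X_γ'` is norm-closed and complete. By
Hahn–Banach in `(X, γ)`, applied to the seminorms of `Γ`, evaluation is isometric
(`norm_mixedEval`). Banach–Steinhaus on the Banach space `X_γ'` then makes `γ`-bounded sets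
norm-bounded, so the strong topology is the norm topology, and semi-reflexivity is exactly
surjectivity of evaluation. Admissible topologies are merely linear, so local convexity of `γ` needs
its own proof (`exists_isContinuousOnBounded_of_mem_nhds`). -/

theorem eventually_nhds_of_induced_eq {X : Type*} {s t : TopologicalSpace X} {B : Set X}
    (h : TopologicalSpace.induced ((↑) : B → X) s = TopologicalSpace.induced ((↑) : B → X) t)
    {x : X} (hx : x ∈ B) {V : Set X} (hV : V ∈ @nhds X s x) :
    ∀ᶠ y in @nhds X t x, y ∈ B → y ∈ V := by
  have h1 : ((↑) : B → X) ⁻¹' V ∈ @nhds B (TopologicalSpace.induced (↑) s) ⟨x, hx⟩ := by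
    rw [@nhds_induced]
    exact Filter.preimage_mem_comap hV
  rw [h, @nhds_induced] at h1
  obtain ⟨U, hU, hUV⟩ := h1
  filter_upwards [hU] with y hy hyB
  exact hUV (show (⟨y, hyB⟩ : B) ∈ _ from hy)

/-- The linear topology generated by a single seminorm. -/
theorem Seminorm.exists_isVectorTopology {𝕜 X : Type*} [RCLike 𝕜] [AddCommGroup X] [Module 𝕜 X]
    (p : Seminorm 𝕜 X) : ∃ t : TopologicalSpace X, IsVectorTopology 𝕜 t ∧ Continuous[t, _] p ∧
      ∀ (Y : Type _) (s : TopologicalSpace Y) (u : Y → X),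
        (∀ y, ∀ ε > 0, ∀ᶠ z in 𝓝 y, p (u z - u y) < ε) → Continuous[s, t] u := by
  let q : SeminormFamily 𝕜 X Unit := fun _ => p
  let _ := q.moduleFilterBasis.topology
  have hq : WithSeminorms q := ⟨rfl⟩
  refine ⟨_, ⟨hq.topologicalAddGroup, hq.continuousSMul⟩, hq.continuous_seminorm (), ?_⟩
  intro Y s u hu
  refine continuous_iff_continuousAt.2 fun y => (hq.tendsto_nhds' _ _).2 fun F ε hε => ?_
  filter_upwards [hu y ε hε] with z hz
  exact Seminorm.finset_sup_apply_lt hε fun _ _ => hz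

/-! ### Seminorms continuous for the mixed topology. -/

namespace PreSaksSpace

variable {𝕜 : Type*} [RCLike 𝕜] {X : Type*} [NormedAddCommGroup X] [NormedSpace 𝕜 X]

/-- The seminorm `p` is `τ`-continuous at `0` on every norm-bounded set. -/
def IsContinuousOnBounded (S : PreSaksSpace 𝕜 X) (p : Seminorm 𝕜 X) : Prop :=
  ∀ r ε : ℝ, 0 < ε → ∀ᶠ x in @nhds X S.tau 0, ‖x‖ ≤ r → p x < ε

variable (S : PreSaksSpace 𝕜 X)

theorem eventually_mem_of_mem_nhds_mixedTopology {V : Set X}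
    (hV : V ∈ @nhds X S.mixedTopology 0) {r : ℝ} (hr : 0 ≤ r) :
    ∀ᶠ x in @nhds X S.tau 0, ‖x‖ ≤ r → x ∈ V := by
  have := eventually_nhds_of_induced_eq
    (S.isLeast_mixedTopology.1.2.1 _ (Metric.isBounded_closedBall (x := (0 : X)) (r := r)))
    (Metric.mem_closedBall_self hr) hV
  simpa using this

variable {S}

theorem IsContinuousOnBounded.continuous_norm {p : Seminorm 𝕜 X} (hp : S.IsContinuousOnBounded p) :
    Continuous p := by
  refine Seminorm.continuous (𝕜 := 𝕜) (r := 1) ?_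
  have h1 : ∀ᶠ x in 𝓝 (0 : X), ‖x‖ ≤ 1 → p x < 1 :=
    nhds_mono S.normTopology_le (hp 1 1 one_pos)
  filter_upwards [h1, Metric.closedBall_mem_nhds (0 : X) one_pos] with x hx hx1
  rw [Seminorm.mem_ball_zero]
  exact hx (by simpa using hx1)

/-- The join of `τ` with the topology of `p` is admissible, hence coarser than `γ`. -/
theorem IsContinuousOnBounded.continuous_mixedTopology {p : Seminorm 𝕜 X}
    (hp : S.IsContinuousOnBounded p) : @Continuous X ℝ S.mixedTopology _ p := by
  have hnorm (x : X) : Filter.Tendsto (fun y => p (y - x)) (𝓝 x) (𝓝 0) := by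
    have : Continuous fun y => p (y - x) := hp.continuous_norm.comp (continuous_sub_right x)
    simpa using this.tendsto x
  obtain ⟨t, htv, ht, htc⟩ := p.exists_isVectorTopology
  have hmem : S.tau ⊓ t ∈ S.admissible := by
    refine ⟨⟨topologicalAddGroup_inf S.isLinearTopology.1 htv.1,
      @continuousSMul_inf _ _ _ _ _ _ S.isLinearTopology.2 htv.2⟩, fun B hB => ?_,
      inf_le_left, le_inf S.normTopology_le (continuous_id_iff_le.1 ?_)⟩
    · rw [induced_inf]
      refine inf_eq_left.2 (continuous_iff_le_induced.1 (htc _ _ _ fun x ε hε => ?_))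
      -- A ball centred at `x` bounds the differences `y - x`, so the hypothesis at `0` gives
      -- continuity on `B` at `x`.
      obtain ⟨r, hr⟩ := hB.subset_closedBall (x : X)
      have h0 : Filter.Tendsto (fun y : B => (y : X) - x)
          (@nhds _ (TopologicalSpace.induced (↑) S.tau) x) (@nhds X S.tau 0) := by
        let _ := S.tau
        have : IsTopologicalAddGroup X := S.isLinearTopology.1
        have : Continuous fun y : B => (y : X) - x := continuous_subtype_val.sub continuous_const
        simpa using this.tendsto x
      filter_upwards [h0.eventually (hp r ε hε)] with y hy
      exact hy (by simpa [dist_eq_norm] using hr y.2)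
    · exact htc _ _ _ fun x ε hε => (hnorm x).eventually (gt_mem_nhds hε)
  exact continuous_le_dom ((sInf_le hmem).trans inf_le_right) ht

theorem IsContinuousOnBounded.of_continuous {p : Seminorm 𝕜 X}
    (hp : @Continuous X ℝ S.mixedTopology _ p) : S.IsContinuousOnBounded p := by
  intro r ε hε
  have h0 : {x | p x < ε} ∈ @nhds X S.mixedTopology 0 := by
    refine (@Continuous.tendsto X ℝ S.mixedTopology _ p hp 0) (gt_mem_nhds ?_)
    simpa using hε
  -- `r` may be negative, while the ball used must contain `0`.
  filter_upwards [S.eventually_mem_of_mem_nhds_mixedTopology h0 (le_max_right r 0)] with x hx hxr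
  exact hx (hxr.trans (le_max_left _ _))

/-! ### Local convexity of the mixed topology. -/

open Pointwise in
/-- The gauge of an absolutely convex set which is a `τ`-neighbourhood of `0` relative to
every ball. -/
theorem exists_isContinuousOnBounded_of_absConvex [NormedSpace ℝ X] [IsScalarTower ℝ 𝕜 X]
    {W : Set X} (hb : Balanced 𝕜 W) (hc : Convex ℝ W)
    (hW : ∀ r : ℝ, ∀ᶠ x in @nhds X S.tau 0, ‖x‖ ≤ r → x ∈ W) :
    ∃ p : Seminorm 𝕜 X, S.IsContinuousOnBounded p ∧ ∀ x, p x < 1 → x ∈ W := by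
  have hn : W ∈ 𝓝 (0 : X) := by
    have h1 : ∀ᶠ x in 𝓝 (0 : X), ‖x‖ ≤ 1 → x ∈ W := nhds_mono S.normTopology_le (hW 1)
    filter_upwards [h1, Metric.closedBall_mem_nhds (0 : X) one_pos] with x hx hx1
    exact hx (by simpa using hx1)
  have ha : Absorbent ℝ W := absorbent_nhds_zero hn
  refine ⟨gaugeSeminorm hb hc ha, fun r ε hε => ?_, fun x hx =>
    setOfPred_gauge_lt_one_subset_self hc (mem_of_mem_nhds hn) ha hx⟩
  -- Dilation by `2 / ε` stays within the bounded-set hypothesis, with a larger radius; `ε / 2`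
  -- leaves room for the strict inequality.
  have hc : Filter.Tendsto (fun x : X => ((ε / 2 : ℝ) : 𝕜)⁻¹ • x) (@nhds X S.tau 0)
      (@nhds X S.tau 0) := by
    let _ := S.tau
    have : ContinuousSMul 𝕜 X := S.isLinearTopology.2
    have : Continuous (fun x : X => ((ε / 2 : ℝ) : 𝕜)⁻¹ • x) := continuous_const_smul _
    simpa using this.tendsto 0
  filter_upwards [hc.eventually (hW (‖((ε / 2 : ℝ) : 𝕜)⁻¹‖ * r))] with x hx hxr
  have h2 := hx (by rw [norm_smul]; gcongr)
  have h3 : ((ε / 2 : ℝ) : 𝕜)⁻¹ • x = (ε / 2)⁻¹ • x := by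
    rw [← RCLike.ofReal_inv]
    exact RCLike.real_smul_eq_coe_smul (K := 𝕜) _ x |>.symm
  rw [h3] at h2
  have h4 : gauge W x ≤ ε / 2 :=
    gauge_le_of_mem (by positivity) ((Set.mem_smul_set_iff_inv_smul_mem₀ (by positivity) _ _).2 h2)
  exact h4.trans_lt (by linarith)

theorem exists_seminorm_of_eventually {V : Set X} {r : ℝ}
    (hV : ∀ᶠ x in @nhds X S.tau 0, ‖x‖ ≤ r → x ∈ V) :
    ∃ (q : Seminorm 𝕜 X) (δ : ℝ), (∀ᶠ x in @nhds X S.tau 0, x ∈ q.ball 0 δ) ∧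
      q.ball 0 δ ∩ (normSeminorm 𝕜 X).closedBall 0 r ⊆ V := by
  let _ := S.tau
  have := S.polynormable
  have hb := (PolynormableSpace.withSeminorms 𝕜 X).hasBasis_zero_ball
  obtain ⟨⟨s, δ⟩, hδ, hs⟩ := hb.mem_iff.1 hV
  refine ⟨_, δ, hb.mem_of_mem hδ, fun x hx => hs hx.1 (by simpa using hx.2)⟩

-- Inside `V`, an absolutely convex set is built as the union of the sums `A 0 + ⋯ + A (n - 1)`,
-- where `A k` is a `τ`-ball cut by the norm ball of radius `k`. Its gauge is the required seminorm.
open Pointwise in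
theorem exists_isContinuousOnBounded_of_mem_nhds {V : Set X}
    (hV : V ∈ @nhds X S.mixedTopology 0) :
    ∃ p : Seminorm 𝕜 X, S.IsContinuousOnBounded p ∧ ∀ x, p x < 1 → x ∈ V := by
  have half : ∀ V ∈ @nhds X S.mixedTopology 0,
      ∃ U ∈ @nhds X S.mixedTopology 0, ∀ v ∈ U, ∀ w ∈ U, v + w ∈ V := fun V hV =>
    let _ := S.mixedTopology
    have : IsTopologicalAddGroup X := S.isLinearTopology_mixedTopology.1
    exists_nhds_zero_half hV
  choose! H hH hHadd using half
  let U : ℕ → Set X := fun n => H^[n] V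
  have hUs : ∀ n, U (n + 1) = H (U n) := fun n => Function.iterate_succ_apply' H n V
  have hU : ∀ n, U n ∈ @nhds X S.mixedTopology 0 := by
    intro n
    induction n with
    | zero => exact hV
    | succ n ih => rw [hUs]; exact hH _ ih
  -- The shift to `U (n + 1)` gives `A n + U (n + 1) ⊆ U n`; the radii `n` exhaust all norm balls.
  choose q δ hqδ hqU using fun n : ℕ => S.exists_seminorm_of_eventually (𝕜 := 𝕜)
    (S.eventually_mem_of_mem_nhds_mixedTopology (hU (n + 1)) (Nat.cast_nonneg n))
  let A : ℕ → Set X := fun n => (q n).ball 0 (δ n) ∩ (normSeminorm 𝕜 X).closedBall 0 n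
  let T : ℕ → Set X := fun n => Nat.rec {0} (fun k s => s + A k) n
  have hT0 : T 0 = {0} := rfl
  have hTs : ∀ n, T (n + 1) = T n + A n := fun n => rfl
  have hA0 : ∀ n, (0 : X) ∈ A n := fun n => by
    exact ⟨@mem_of_mem_nhds X S.tau _ _ (hqδ n), by simp⟩
  have hTU : ∀ n, T n + U n ⊆ V := by
    intro n
    induction n with
    | zero => rw [hT0, Set.singleton_zero, zero_add]; exact subset_rfl
    | succ n ih =>
      refine subset_trans ?_ ih
      rw [hTs, add_assoc]
      refine Set.add_subset_add_left ?_
      rintro _ ⟨a, ha, u, hu, rfl⟩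
      exact hHadd _ (hU n) a (hUs n ▸ hqU n ha) u (hUs n ▸ hu)
  have hmono : Monotone T := monotone_nat_of_le_succ fun n x hx =>
    ⟨x, hx, 0, hA0 n, add_zero x⟩
  let _ : NormedSpace ℝ X := NormedSpace.restrictScalars ℝ 𝕜 X
  have : IsScalarTower ℝ 𝕜 X := IsScalarTower.restrictScalars ..
  have hcA : ∀ n, Convex ℝ (A n) := fun n =>
    (Seminorm.convex_ball _ _ _).inter (Seminorm.convex_closedBall _ _ _)
  have hbA : ∀ n, Balanced 𝕜 (A n) := fun n =>
    (Seminorm.balanced_ball_zero _ _).inter (Seminorm.balanced_closedBall_zero _ _)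
  have hcT : ∀ n, Convex ℝ (T n) := by
    intro n
    induction n with
    | zero => exact convex_singleton 0
    | succ n ih => exact ih.add (hcA n)
  have hbT : ∀ n, Balanced 𝕜 (T n) := by
    intro n
    induction n with
    | zero => exact balanced_zero
    | succ n ih => exact ih.add (hbA n)
  obtain ⟨p, hp, hpW⟩ := exists_isContinuousOnBounded_of_absConvex (S := S) (W := ⋃ n, T n)
    (balanced_iUnion hbT) ((directed_of_isDirected_le hmono).convex_iUnion fun {n} => hcT n) (by
      intro r
      obtain ⟨n, hn⟩ := exists_nat_ge r
      filter_upwards [hqδ n] with x hx hxr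
      refine Set.mem_iUnion.2 ⟨n + 1, 0, ?_, x, ⟨hx, ?_⟩, zero_add x⟩
      · exact hmono (Nat.zero_le n) rfl
      · simpa [Seminorm.mem_closedBall] using hxr.trans hn)
  refine ⟨p, hp, fun x hx => ?_⟩
  obtain ⟨n, hn⟩ := Set.mem_iUnion.1 (hpW x hx)
  refine hTU n ⟨x, hn, 0, ?_, add_zero x⟩
  exact @mem_of_mem_nhds X S.mixedTopology _ _ (hU n)

end PreSaksSpace

instance PreSaksSpace.polynormableSpace_mixedSpace {𝕜 : Type*} [RCLike 𝕜] {X : Type*}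
    [NormedAddCommGroup X] [NormedSpace 𝕜 X] (S : PreSaksSpace 𝕜 X) :
    PolynormableSpace 𝕜 (MixedSpace S) where
  withSeminorms' := by
    rw [SeminormFamily.withSeminorms_iff_nhds_eq_iInf]
    refine le_antisymm ?_ fun V hV => ?_
    · simp_rw [le_iInf_iff, ← Filter.tendsto_iff_comap]
      exact fun p => map_zero p.1 ▸ p.2.tendsto 0
    · obtain ⟨p, hp, hpV⟩ := exists_isContinuousOnBounded_of_mem_nhds (S := S) hV
      refine Filter.mem_iInf_of_mem (⟨p, hp.continuous_mixedTopology⟩ :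
        {p : Seminorm 𝕜 (MixedSpace S) // Continuous p}) ?_
      exact ⟨_, gt_mem_nhds one_pos, hpV⟩

instance PreSaksSpace.t2Space_mixedSpace {𝕜 : Type*} [RCLike 𝕜] {X : Type*}
    [NormedAddCommGroup X] [NormedSpace 𝕜 X] (S : PreSaksSpace 𝕜 X) : T2Space (MixedSpace S) :=
  t2Space_antitone (sInf_le S.tau_mem_admissible) S.t2
/-- A continuous seminorm is attained at a given vector by a functional which it dominates. -/
theorem Seminorm.exists_dual_vector {𝕜 E : Type*} [RCLike 𝕜] [AddCommGroup E] [Module 𝕜 E]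
    [TopologicalSpace E] [PolynormableSpace 𝕜 E] {q : Seminorm 𝕜 E} (hq : Continuous q) (x : E) :
    ∃ g : StrongDual 𝕜 E, g x = (q x : 𝕜) ∧ ∀ y, ‖g y‖ ≤ q y := by
  rcases eq_or_ne x 0 with rfl | hx
  · exact ⟨0, by simp, by simp⟩
  let e := LinearEquiv.toSpanNonzeroSingleton 𝕜 E x hx
  let f : Module.Dual 𝕜 (Submodule.span 𝕜 {x}) := ((q x : ℝ) : 𝕜) • e.symm.toLinearMap
  have hf (c : 𝕜) : f (e c) = (q x : 𝕜) * c := by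
    change (q x : 𝕜) * e.symm (e c) = _
    rw [e.symm_apply_apply]
  have he (c : 𝕜) : (e c : E) = c • x := rfl
  obtain ⟨g, hg, hgq⟩ := Module.Dual.exists_continuous_extension_of_le_seminorm
    (Submodule.span 𝕜 {x}) f hq (fun y => by
      obtain ⟨c, rfl⟩ := e.surjective y
      rw [hf, he, map_smul_eq_mul, norm_mul, RCLike.norm_ofReal,
        abs_of_nonneg (apply_nonneg q x), mul_comm])
  refine ⟨g, ?_, hgq⟩
  have := hg (e 1)
  rwa [hf, he, one_smul, mul_one] at this

/-! ### The dual of `(X, γ)` as a closed subspace. -/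

namespace PreSaksSpace

variable {𝕜 : Type*} [RCLike 𝕜] {X : Type*} [NormedAddCommGroup X] [NormedSpace 𝕜 X]
  {S : PreSaksSpace 𝕜 X}

theorem mem_mixedDual_iff {f : StrongDual 𝕜 X} :
    f ∈ mixedDual S ↔ S.IsContinuousOnBounded ((normSeminorm 𝕜 𝕜).comp f.toLinearMap) := by
  constructor
  · rintro ⟨g, rfl⟩
    exact .of_continuous (S := S) g.continuous.norm
  · intro hf
    let f' : MixedSpace S →ₗ[𝕜] 𝕜 := f.toLinearMap
    have h : Continuous fun x => ‖f' x‖ := hf.continuous_mixedTopology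
    have hc : Continuous f' := by
      refine continuous_of_continuousAt_zero f' ?_
      rw [ContinuousAt, map_zero, tendsto_zero_iff_norm_tendsto_zero]
      simpa using h.tendsto 0
    exact ⟨⟨f', hc⟩, rfl⟩

/-- Norm limits of functionals are uniform on balls, so `τ`-continuity there survives. -/
theorem isClosed_mixedDual : IsClosed (mixedDual S : Set (StrongDual 𝕜 X)) := by
  refine isClosed_of_closure_subset fun f hf => mem_mixedDual_iff.2 fun r ε hε => ?_
  obtain ⟨g, hg, hfg⟩ := Metric.mem_closure_iff.1 hf (ε / 2 / (|r| + 1)) (by positivity)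
  filter_upwards [mem_mixedDual_iff.1 hg r (ε / 2) (half_pos hε)] with x hx hxr
  have h1 : ‖g x‖ < ε / 2 := hx hxr
  have h2 : ‖(f - g) x‖ ≤ ε / 2 := by
    refine ((f - g).le_opNorm x).trans ?_
    rw [dist_eq_norm] at hfg
    calc ‖f - g‖ * ‖x‖ ≤ ε / 2 / (|r| + 1) * (|r| + 1) := by
          gcongr
          exact hxr.trans ((le_abs_self r).trans (by linarith))
      _ = ε / 2 := by field_simp
  have h3 : ‖f x‖ ≤ ‖(f - g) x‖ + ‖g x‖ := by
    simpa using norm_add_le ((f - g) x) (g x)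
  change ‖f x‖ < ε
  linarith

instance completeSpace_normedBy : CompleteSpace (NormedBy (mixedDualNorm S)) := by
  let φ : NormedBy (mixedDualNorm S) →ₗ[𝕜] StrongDual 𝕜 X := mixedDualIncl S
  have hφ : Isometry φ := AddMonoidHomClass.isometry_of_norm φ fun _ => rfl
  refine (completeSpace_iff_isComplete_range hφ.isUniformInducing).2 ?_
  exact (isClosed_mixedDual (S := S)).isComplete

end PreSaksSpace

/-! ### The strong dual and the evaluation map. -/

namespace SaksSpace

variable {𝕜 : Type*} [RCLike 𝕜] {X : Type*} [NormedAddCommGroup X] [NormedSpace 𝕜 X]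
  (S : SaksSpace 𝕜 X)

theorem norm_mixedEval (x : X) : ‖mixedEval S.toPreSaksSpace x‖ = ‖x‖ := by
  refine le_antisymm (ContinuousLinearMap.opNorm_le_bound _ (norm_nonneg x) fun f => ?_) ?_
  · rw [mul_comm]
    exact (mixedDualIncl S.toPreSaksSpace f).le_opNorm x
  obtain ⟨Γ, -, hΓ, hsup⟩ := S.exists_seminorms
  refine (hsup x).2 ?_
  rintro _ ⟨q, hq, rfl⟩
  have hqc : Continuous[S.mixedTopology, _] q :=
    continuous_le_dom (sInf_le S.tau_mem_admissible)
      (@WithSeminorms.continuous_seminorm _ _ _ _ _ _ S.tau _ hΓ ⟨q, hq⟩)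
  obtain ⟨g, hgx, hgq⟩ := Seminorm.exists_dual_vector
    (E := MixedSpace S.toPreSaksSpace) (q := q) hqc (toMixed S.toPreSaksSpace x)
  -- `q ≤ ‖·‖` because the norm is the supremum over `Γ`.
  have hgn : ‖toNormedBy (mixedDualNorm S.toPreSaksSpace) g‖ ≤ 1 := by
    refine ContinuousLinearMap.opNorm_le_bound _ zero_le_one fun y => ?_
    rw [one_mul]
    exact (hgq y).trans ((hsup y).1 ⟨q, hq, rfl⟩)
  calc q x = ‖mixedEval S.toPreSaksSpace x (toNormedBy _ g)‖ := by
        rw [mixedEval_apply, hgx, RCLike.norm_ofReal]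
        exact (abs_of_nonneg (apply_nonneg q x)).symm
    _ ≤ ‖mixedEval S.toPreSaksSpace x‖ * 1 :=
        (mixedEval S.toPreSaksSpace x).le_of_opNorm_le_of_le le_rfl hgn
    _ = _ := mul_one _

/-- Uniform boundedness for the evaluations at points of `B`: their common domain `X_γ'` is complete
even if `X` is not, and their norms are the norms of the points. -/
theorem exists_norm_le_of_isVonNBounded {B : Set (MixedSpace S.toPreSaksSpace)}
    (hB : Bornology.IsVonNBounded 𝕜 B) :
    ∃ C : ℝ, ∀ x : X, toMixed S.toPreSaksSpace x ∈ B → ‖x‖ ≤ C := by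
  obtain ⟨C, hC⟩ := banach_steinhaus (𝕜 := 𝕜) (𝕜₂ := 𝕜)
    (g := fun x : {x : X // toMixed S.toPreSaksSpace x ∈ B} => mixedEval S.toPreSaksSpace x.1)
    (fun f => by
      let f' : StrongDual 𝕜 (MixedSpace S.toPreSaksSpace) := f
      obtain ⟨C, hC⟩ := (NormedSpace.isVonNBounded_iff' 𝕜).1 (hB.image f')
      exact ⟨C, fun x => hC _ ⟨_, x.2, rfl⟩⟩)
  exact ⟨C, fun x hx => (S.norm_mixedEval x).symm.le.trans (hC ⟨x, hx⟩)⟩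

/-- One direction uses that the unit ball is `γ`-bounded, the other that `γ`-bounded sets are
norm-bounded. -/
theorem isHomeomorph_toNormedBy : IsHomeomorph (toNormedBy (mixedDualNorm S.toPreSaksSpace)) := by
  let φ : StrongDual 𝕜 (MixedSpace S.toPreSaksSpace) ≃ₗ[𝕜]
      NormedBy (mixedDualNorm S.toPreSaksSpace) := LinearEquiv.refl 𝕜 _
  refine isHomeomorph_iff_exists_inverse.2
    ⟨?_, φ.symm, fun _ => rfl, fun _ => rfl, ?_⟩
  · refine continuous_of_continuousAt_zero φ.toLinearMap ?_
    rw [ContinuousAt, map_zero]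
    refine Metric.nhds_basis_closedBall.tendsto_right_iff.2 fun ε hε => ?_
    have hb := (NormedSpace.isVonNBounded_closedBall 𝕜 X 1).image (toMixed S.toPreSaksSpace)
    filter_upwards [ContinuousLinearMap.eventually_nhds_zero_mapsTo hb
      (Metric.closedBall_mem_nhds (0 : 𝕜) hε)] with f hf
    rw [mem_closedBall_zero_iff]
    refine ContinuousLinearMap.opNorm_le_of_unit_norm hε.le fun x hx => ?_
    exact mem_closedBall_zero_iff.1 (hf ⟨x, by simp [hx], rfl⟩)
  · refine continuous_of_continuousAt_zero φ.symm.toLinearMap ?_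
    rw [ContinuousAt, map_zero, ContinuousLinearMap.nhds_zero_eq_of_basis Metric.nhds_basis_ball]
    simp only [Filter.tendsto_iInf, Filter.tendsto_principal]
    intro B hB ε hε
    obtain ⟨C, hC⟩ := S.exists_norm_le_of_isVonNBounded hB
    filter_upwards [Metric.ball_mem_nhds (0 : NormedBy (mixedDualNorm S.toPreSaksSpace))
      (show 0 < ε / (|C| + 1) by positivity)] with f hf x' hx
    rw [mem_ball_zero_iff] at hf ⊢
    let x : X := x'
    let g := mixedDualIncl S.toPreSaksSpace f
    calc ‖g x‖ ≤ ‖g‖ * ‖x‖ := g.le_opNorm _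
      _ ≤ ‖g‖ * (|C| + 1) := by
        gcongr
        exact (hC x hx).trans ((le_abs_self C).trans (lt_add_one _).le)
      _ < ε / (|C| + 1) * (|C| + 1) := by gcongr; exact hf
      _ = ε := by field_simp

theorem isCompletelyNormableBy : IsCompletelyNormableBy (mixedDualNorm S.toPreSaksSpace) :=
  ⟨inferInstance, S.isHomeomorph_toNormedBy⟩

theorem isIsometricIso_mixedEval (hS : IsSemiReflexive 𝕜 (MixedSpace S.toPreSaksSpace)) :
    IsIsometricIso (mixedEval S.toPreSaksSpace) := by
  refine ⟨⟨?_, fun Φ => ?_⟩, S.norm_mixedEval⟩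
  · exact (AddMonoidHomClass.isometry_of_norm _ S.norm_mixedEval).injective
  -- A norm-continuous functional on `X_γ'` is strongly continuous, so semi-reflexivity represents
  -- it by a point.
  · let Ψ : StrongDual 𝕜 (StrongDual 𝕜 (MixedSpace S.toPreSaksSpace)) :=
      { toFun f := Φ (toNormedBy _ f)
        map_add' f g := map_add Φ (toNormedBy _ f) (toNormedBy _ g)
        map_smul' c f := map_smul Φ c (toNormedBy _ f)
        cont := Φ.continuous.comp S.isHomeomorph_toNormedBy.continuous }
    obtain ⟨x, hx⟩ := hS Ψ
    exact ⟨x, ContinuousLinearMap.ext fun f => (hx f).symm⟩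

end SaksSpace

theorem proposition3 {𝕜 : Type*} [RCLike 𝕜] {X : Type*} [NormedAddCommGroup X] [NormedSpace 𝕜 X]
    (S : SaksSpace 𝕜 X) :
    (IsClosed (mixedDual S.toPreSaksSpace : Set (StrongDual 𝕜 X)) ∧
      IsCompletelyNormableBy (mixedDualNorm S.toPreSaksSpace)) ∧
    (IsSemiReflexive 𝕜 (MixedSpace S.toPreSaksSpace) →
      IsIsometricIso (mixedEval S.toPreSaksSpace) ∧
      IsIsometricBidualBanachSpace 𝕜 X ∧
      IsIsometricPrebidual (MixedSpace S.toPreSaksSpace) (mixedDualNorm S.toPreSaksSpace)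
        (mixedEval S.toPreSaksSpace) ∧
      IsIsometricBanachPredual (NormedBy (mixedDualNorm S.toPreSaksSpace))
        (mixedEval S.toPreSaksSpace)) := by
  refine ⟨⟨PreSaksSpace.isClosed_mixedDual, S.isCompletelyNormableBy⟩, fun hS => ?_⟩
  have hI := S.isIsometricIso_mixedEval hS
  have hP : IsIsometricPrebidual (MixedSpace S.toPreSaksSpace) (mixedDualNorm S.toPreSaksSpace)
      (mixedEval S.toPreSaksSpace) :=
    ⟨inferInstance, inferInstance, S.isCompletelyNormableBy, hI⟩
  exact ⟨hI, ⟨MixedSpace S.toPreSaksSpace, _, _, _, inferInstance, inferInstance, _, _, hP⟩, hP,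
    inferInstance, hI⟩
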